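/- **Setting.** Let $S^d$ be the unit sphere in $\mathbb{R}^{d+1}$; a $k$-dimensional subspace of $S^d$ is the intersection of $S^d$ with a $(k+1)$-dimensional linear subspace, and a hyperplane is a $(d-1)$-dimensional subspace. Let $\mathscr{A}$ be a finite collection of $(d-2)$-dimensional subspaces of $S^d$ (a codim-$2$-arrangement); its union is denoted by $\mathscr{A}$ as well. An extension of $\mathscr{A}$ is a finite collection $E$ of subspaces, each a hyperplane or an element of $\mathscr{A}$, such that every element of $\mathscr{A}$ is contained in some hyperplane belonging to $E$. For $S\subseteq E$ and $x\in S^d$, the stratum of $x$ and $S$ is the set of points that can be joined to $x$ by a curve that lies in all elements of $S$ and meets no element of $E\setminus S$. The extension is fine if the nonempty strata are the open cells of a regular CW structure on $S^d$; then $\mathbf{s}$ denotes this regular CW complex, a combinatorial stratification of $S^d$ induced by $\mathscr{A}$. Its faces are the closures of the strata, and the dimension of a face is that of its spherical span. The dual face $\sigma^*$ of a face $\sigma$ of $\mathbf{s}$ is the union of those simplices of the order complex of the face poset of $\mathbf{s}$ that correspond to chains with minimal element $\sigma$. The dual faces form the dual block complex $\mathbf{s}^*$. For $M\subseteq S^d$,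 $\mathrm{R}(\mathbf{s},M)$ is the maximal subcomplex of $\mathbf{s}$ all of whose faces are contained in $M$; for a subcomplex $C$ of $\mathbf{s}^*$, $\mathrm{R}^*(C,M)$ is the minimal subcomplex of $C$ containing all faces of $C$ that are dual to faces of $\mathbf{s}$ intersecting $M$. The complement complex is $\mathscr{K}:=\mathrm{R}^*(\mathbf{s}^*,S^d\setminus\mathscr{A})$. A Morse matching $\Phi$ on $\mathbf{s}$ is a collection of pairs $(\sigma,\Sigma)$ of faces, $\sigma$ a codimension-one face of $\Sigma$, such that no face lies in two different pairs and there is no closed gradient path, i.e. no sequence $(\sigma_0,\Sigma_0),\dots,(\sigma_k,\Sigma_k)$ in $\Phi$ with $k\ge 1$ and $\sigma_0=\sigma_k$ such that $\sigma_{j+1}\ne\sigma_j$ and $\sigma_{j+1}$ is a codimension-one face of $\Sigma_j$ for all $j<k$. Critical faces are the faces that lie in no pair. A face of a subcomplex $D$ of $\mathbf{s}$ is outwardly matched with respect to $(\mathbf{s},D)$ if it is matched with a face not in $D$. The dual matching is $\Phi^*=\{(\Sigma^*,\sigma^*):(\sigma,\Sigma)\in\Phi\}$, and for a subcomplex $D$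 of $\mathbf{s}^*$, $\Phi^*_D$ is the matching on $D$ consisting of all pairs of $\Phi^*$ with both faces in $D$; $\Phi^*_{\mathscr{K}}$ is the complement matching induced by $\Phi$. **Theorem.** Let $\mathscr{A}$ be a codim-$2$-arrangement in $S^d$, let $\mathbf{s}$ be a combinatorial stratification of $S^d$ induced by $\mathscr{A}$, let $\mathscr{K}$ be the complement complex, and let $\Phi$ be a Morse matching on $\mathbf{s}$. Then for every $i\ge 0$ the critical $i$-faces of $\Phi^*_{\mathscr{K}}$ are in one-to-one correspondence with the union of - the critical $(d-i)$-faces of $\Phi$ that are not faces of $\mathrm{R}(\mathbf{s},\mathscr{A})$, and - the outwardly matched $(d-i-1)$-faces of $\Phi$ with respect to the pair $(\mathbf{s},\mathrm{R}(\mathbf{s},\mathscr{A}))$. If, furthermore, $M$ is an open subset of $S^d$ such that all noncritical faces of $\Phi$ intersect $M$, then for every $i\ge 0$ the critical $i$-faces of $\Phi^*_{\mathrm{R}^*(\mathscr{K},M)}$ are in one-to-one correspondence with the union of - the critical $(d-i)$-faces of $\Phi$ that are not faces of $\mathrm{R}(\mathbf{s},\mathscr{A})$ and that intersect $M$, and -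 the outwardly matched $(d-i-1)$-faces of $\Phi$ with respect to the pair $(\mathbf{s},\mathrm{R}(\mathbf{s},\mathscr{A}))$. -/

import Mathlib

namespace MorseDuality

/-! ### Matchings on the faces of a cell complex

A complex is given by its set `C` of (nonempty, closed) faces inside an ambient partial order `P`
of point sets ordered by inclusion, together with the dimension function `dim` of faces. -/

section Matchings

variable {P : Type*} [PartialOrder P]

/-- `σ` is a codimension-one face of `τ`. -/
def IsCodimOneFace (dim : P → ℕ) (σ τ : P) : Prop :=
  σ ≤ τ ∧ dim τ = dim σ + 1

/-- A discrete vector field on `C`: a collection of pairs `(σ, τ)` of faces of `C` with `σ` a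
codimension-one face of `τ`, such that no face belongs to two different pairs. -/
structure IsDiscreteVectorField (C : Set P) (dim : P → ℕ) (Φ : Set (P × P)) : Prop where
  mem : ∀ p ∈ Φ, p.1 ∈ C ∧ p.2 ∈ C
  codimOne : ∀ p ∈ Φ, IsCodimOneFace dim p.1 p.2
  unique : ∀ p ∈ Φ, ∀ q ∈ Φ, ∀ σ : P, (σ = p.1 ∨ σ = p.2) → (σ = q.1 ∨ σ = q.2) → p = q

/-- `(σ 0, τ 0), …, (σ k, τ k)` with `1 ≤ k` is a gradient path of `Φ`. -/
structure IsGradientPath (dim : P → ℕ) (Φ : Set (P × P)) (k : ℕ) (σ τ : ℕ → P) : Prop where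
  one_le : 1 ≤ k
  mem : ∀ j ≤ k, (σ j, τ j) ∈ Φ
  ne : ∀ j < k, σ (j + 1) ≠ σ j
  codimOne : ∀ j < k, IsCodimOneFace dim (σ (j + 1)) (τ j)

/-- A Morse matching: a discrete vector field without closed gradient paths. -/
structure IsMorseMatching (C : Set P) (dim : P → ℕ) (Φ : Set (P × P)) : Prop where
  vectorField : IsDiscreteVectorField C dim Φ
  noClosedPath : ∀ (k : ℕ) (σ τ : ℕ → P), IsGradientPath dim Φ k σ τ → σ 0 ≠ σ k

/-- The critical faces: the faces of `C` that are in none of the matching pairs. -/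
def criticalFaces (C : Set P) (Φ : Set (P × P)) : Set P :=
  {σ | σ ∈ C ∧ ∀ p ∈ Φ, σ ≠ p.1 ∧ σ ≠ p.2}

/-- The critical faces of dimension `i`. -/
def criticalFacesOfDim (C : Set P) (dim : P → ℕ) (Φ : Set (P × P)) (i : ℕ) : Set P :=
  {σ | σ ∈ criticalFaces C Φ ∧ dim σ = i}

/-- The restriction of a matching to a subcomplex `D`: all pairs involving two faces of `D`. -/
def restrictMatching (Φ : Set (P × P)) (D : Set P) : Set (P × P) :=
  {p | p ∈ Φ ∧ p.1 ∈ D ∧ p.2 ∈ D}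

/-- The outwardly matched faces of the subcomplex `D`: the faces of `D` that are matched by `Φ`
with a face not belonging to `D`. -/
def outwardlyMatched (D : Set P) (Φ : Set (P × P)) : Set P :=
  {σ | σ ∈ D ∧ ∃ τ, τ ∉ D ∧ ((σ, τ) ∈ Φ ∨ (τ, σ) ∈ Φ)}

/-- `D` is a subcomplex of `C`: a set of faces of `C` containing all faces (in `C`) of its
members. -/
def IsSubcomplex (C D : Set P) : Prop :=
  D ⊆ C ∧ ∀ σ ∈ C, ∀ τ ∈ D, σ ≤ τ → σ ∈ D

end Matchings

/-! ### Barycentric subdivision and the dual block complex -/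

section Dual

variable {P : Type*} [PartialOrder P]

/-- The order complex `sd C` of the face poset of `C`: its simplices are the nonempty finite
chains of faces. -/
def orderComplex (C : Set P) : PreAbstractSimplicialComplex P where
  faces := {c | c.Nonempty ∧ (c : Set P) ⊆ C ∧ IsChain (· ≤ ·) (c : Set P)}
  isRelLowerSet_faces := by
    rintro c ⟨hne, hC, hch⟩
    refine ⟨hne, fun b hb hbne => ⟨hbne, ?_, ?_⟩⟩
    · exact fun x hx => hC (hb hx)
    · exact hch.mono (fun x hx => hb hx)

/-- The dual face `σ*`: the union of the closed simplices of `sd C` that correspond to chains with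
minimal element `σ`, as a subcomplex of `sd C`. Dual faces are ordered by inclusion. -/
def dualFace (C : Set P) (σ : P) : PreAbstractSimplicialComplex P where
  faces := {c | c.Nonempty ∧ ∃ c' ∈ orderComplex C, c ⊆ c' ∧ IsLeast (c' : Set P) σ}
  isRelLowerSet_faces := by
    rintro c ⟨hne, c', hc', hcc', hl⟩
    exact ⟨hne, fun b hb hbne => ⟨hbne, c', hc', fun x hx => hcc' (hb hx), hl⟩⟩

/-- The dual block complex `C*`, as its set of faces. -/
def dualComplex (C : Set P) : Set (PreAbstractSimplicialComplex P) :=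
  dualFace C '' C

/-- The dimension of a block, i.e. of a (finite-dimensional, nonempty) simplicial complex: the
largest dimension of one of its simplices. -/
noncomputable def blockDim (K : PreAbstractSimplicialComplex P) : ℕ :=
  sSup ((fun c : Finset P => c.card - 1) '' K.faces)

/-- The dual matching `Φ* = {(τ*, σ*) : (σ, τ) ∈ Φ}`. -/
def dualMatching (C : Set P) (Φ : Set (P × P)) :
    Set (PreAbstractSimplicialComplex P × PreAbstractSimplicialComplex P) :=
  (fun p => (dualFace C p.2, dualFace C p.1)) '' Φ

end Dual

/-! ### Codim-2-arrangements in the sphere and their stratifications -/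

/-- The unit sphere `S^d` in `ℝ^(d+1)`. -/
abbrev Sph (d : ℕ) : Type := Metric.sphere (0 : EuclideanSpace ℝ (Fin (d + 1))) 1

/-- The ambient linear subspaces. A `k`-dimensional subspace of `S^d` is encoded by the
`(k+1)`-dimensional linear subspace of `ℝ^(d+1)` that cuts it out. -/
abbrev LinSub (d : ℕ) : Type := Submodule ℝ (EuclideanSpace ℝ (Fin (d + 1)))

/-- The subspace of `S^d` cut out by a linear subspace. -/
def trace {d : ℕ} (L : LinSub d) : Set (Sph d) :=
  {x | (x : EuclideanSpace ℝ (Fin (d + 1))) ∈ L}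

/-- Hyperplanes of `S^d`: subspaces of dimension `d - 1`. -/
def IsHyperplane {d : ℕ} (L : LinSub d) : Prop :=
  Module.finrank ℝ L + 1 = d + 1

/-- A codim-2-arrangement in `S^d`: a finite collection of `(d-2)`-dimensional subspaces. -/
def IsCodimTwoArrangement {d : ℕ} (A : Set (LinSub d)) : Prop :=
  A.Finite ∧ ∀ h ∈ A, Module.finrank ℝ h + 2 = d + 1

/-- The union of the elements of an arrangement. -/
def support {d : ℕ} (A : Set (LinSub d)) : Set (Sph d) :=
  ⋃ h ∈ A, trace h

/-- `E` is an extension of the arrangement `A`: a finite collection that consists of hyperplanes,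
among them one through every element of `A`, and possibly of elements of `A` itself (these have to
be added to `E` whenever the strata are supposed to subdivide the elements of `A`). -/
structure IsExtension {d : ℕ} (A E : Set (LinSub d)) : Prop where
  finite : E.Finite
  mem : ∀ L ∈ E, IsHyperplane L ∨ L ∈ A
  exists_hyperplane : ∀ h ∈ A, ∃ H ∈ E, IsHyperplane H ∧ h ≤ H

/-- The set of points that lie in all elements of `S` and in no element of `E \ S`. -/
def locus {d : ℕ} (E S : Set (LinSub d)) : Set (Sph d) :=
  {x | (∀ L ∈ S, x ∈ trace L) ∧ ∀ L ∈ E \ S, x ∉ trace L}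

/-- The nonempty strata: the sets of all points that can be joined to a point `x` by a curve that
lies in all elements of `S` and meets no element of `E \ S`. -/
def strata {d : ℕ} (E : Set (LinSub d)) : Set (Set (Sph d)) :=
  {T | T.Nonempty ∧ ∃ S ⊆ E, ∃ x : Sph d, T = pathComponentIn (locus E S) x}

/-- The extension `E` is fine: `S^d` has the structure of a regular CW complex (every
characteristic map is injective on the closed ball) whose open cells are the strata. -/
def IsFine {d : ℕ} (E : Set (LinSub d)) : Prop :=
  ∃ cw : Topology.CWComplex (Set.univ : Set (Sph d)),
    {T : Set (Sph d) | ∃ (n : ℕ) (e : cw.cell n), T = cw.map n e '' Metric.ball 0 1} = strata E ∧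
    ∀ (n : ℕ) (e : cw.cell n), Set.InjOn (cw.map n e) (Metric.closedBall 0 1)

/-- The faces of the stratification: the closures of the strata. -/
def stratFaces {d : ℕ} (E : Set (LinSub d)) : Set (Set (Sph d)) :=
  closure '' strata E

/-- The dimension of a nonempty convex subset of `S^d`, i.e. of its spherical span. -/
noncomputable def sphDim {d : ℕ} (σ : Set (Sph d)) : ℕ :=
  Module.finrank ℝ (Submodule.span ℝ
    ((fun x : Sph d => (x : EuclideanSpace ℝ (Fin (d + 1)))) '' σ)) - 1

/-- `R(C, M)`: the maximal subcomplex of `C` all of whose faces are contained in `M`. -/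
def restr {d : ℕ} (C : Set (Set (Sph d))) (M : Set (Sph d)) : Set (Set (Sph d)) :=
  ⋃₀ {D | IsSubcomplex C D ∧ ∀ σ ∈ D, σ ⊆ M}

/-- `R*(C, M)` for a subcomplex `C` of the dual block complex of `s`: the minimal subcomplex of `C`
containing all those faces of `C` that are dual to faces of `s` intersecting `M`. -/
def dualRestr {d : ℕ} (s : Set (Set (Sph d)))
    (C : Set (PreAbstractSimplicialComplex (Set (Sph d)))) (M : Set (Sph d)) :
    Set (PreAbstractSimplicialComplex (Set (Sph d))) :=
  ⋂₀ {D | IsSubcomplex C D ∧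
    ∀ σ ∈ s, (σ ∩ M).Nonempty → dualFace s σ ∈ C → dualFace s σ ∈ D}

/-- The complement complex `K(A, s) = R*(s*, S^d \ A)`. -/
def complementComplex {d : ℕ} (A : Set (LinSub d)) (s : Set (Set (Sph d))) :
    Set (PreAbstractSimplicialComplex (Set (Sph d))) :=
  dualRestr s (dualComplex s) (support A)ᶜ

end MorseDuality

open MorseDuality

/-! Taking dual blocks reverses inclusion and is injective on faces (`dualFace_le_iff`,
`dualFace_injOn`). Both complexes of the theorem consist of the blocks dual to an upward closed set
N of faces: those not contained in the arrangement, respectively those that in addition meet M. A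
block σ* with σ in N is critical for the restricted dual matching exactly when σ is critical for Φ
or its partner lies outside N. As N is upward closed, such a partner is a codimension-one face of σ,
and sending it to σ* gives the bijection (`nonempty_equiv_criticalFacesOfDim_dual`).

The indices require dim σ* = d - dim σ, so every face must start a chain of faces rising by one
dimension at a time up to d. A stratum is relatively open in the flat it spans, hence dimension is
strictly monotone. The hyperplanes through the codimension-two elements ensure that every proper
flat lies in a flat of one more dimension (`exists_flat_finrank_eq_add_one`); pushing a stratum into
that flat yields the next face (`exists_mem_stratFaces_sphDim_eq_add_one`). -/

namespace MorseDuality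

/-! ### Dual blocks and critical faces in an abstract face poset -/

section DualOrder

variable {P : Type*} [PartialOrder P] {C N : Set P}

theorem mem_dualFace {σ : P} {c : Finset P} : c ∈ (dualFace C σ).faces ↔
    c.Nonempty ∧ ∃ c' ∈ (orderComplex C).faces, c ⊆ c' ∧ IsLeast (c' : Set P) σ :=
  Iff.rfl

/-- The vertex τ of τ* lies in σ* only if some chain with minimum σ contains τ. Conversely,
adjoining σ below a chain with minimum τ gives a chain with minimum σ. -/
theorem dualFace_le_iff {σ τ : P} (hσ : σ ∈ C) (hτ : τ ∈ C) :
    dualFace C τ ≤ dualFace C σ ↔ σ ≤ τ := by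
  classical
  constructor
  · intro h
    have hmem : ({τ} : Finset P) ∈ (dualFace C τ).faces :=
      ⟨by simp, {τ}, ⟨by simp, by simpa using hτ, by simp⟩, subset_rfl, by simp⟩
    obtain ⟨-, c', -, hsub, hl⟩ := h hmem
    exact hl.2 (hsub (by simp))
  · rintro h c ⟨hne, c', ⟨-, hC, hch⟩, hsub, hl⟩
    refine ⟨hne, insert σ c', ⟨by simp, ?_, ?_⟩, hsub.trans (Finset.subset_insert _ _), ?_⟩
    · rw [Finset.coe_insert]
      exact Set.insert_subset hσ hC
    · rw [Finset.coe_insert]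
      exact hch.insert fun b hb _ => Or.inl (h.trans (hl.2 hb))
    · refine ⟨by simp, fun b hb => ?_⟩
      rw [Finset.coe_insert] at hb
      rcases hb with rfl | hb
      · exact le_rfl
      · exact h.trans (hl.2 hb)

theorem dualFace_injOn : Set.InjOn (dualFace C) C := fun _ hσ _ hτ h =>
  le_antisymm ((dualFace_le_iff hσ hτ).1 h.ge) ((dualFace_le_iff hτ hσ).1 h.le)

/-- The block dual to `σ` has dimension `m - dim σ`, provided that every face of dimension less than
`m` is a proper face of one whose dimension is larger by one. -/
theorem blockDim_dualFace_add {dim : P → ℕ} {m : ℕ} (hle : ∀ σ ∈ C, dim σ ≤ m)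
    (hmono : ∀ σ ∈ C, ∀ τ ∈ C, σ < τ → dim σ < dim τ)
    (hstep : ∀ σ ∈ C, dim σ < m → ∃ τ ∈ C, σ < τ ∧ dim τ = dim σ + 1) {σ : P} (hσ : σ ∈ C) :
    blockDim (dualFace C σ) + dim σ = m := by
  classical
  have hchain : ∀ n, ∀ σ ∈ C, dim σ + n = m → ∃ c ∈ (orderComplex C).faces,
      IsLeast (c : Set P) σ ∧ c.card = n + 1 := by
    intro n
    induction n with
    | zero =>
      intro σ hσ _
      exact ⟨{σ}, ⟨by simp, by simpa using hσ, by simp⟩, by simp, by simp⟩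
    | succ n ih =>
      intro σ hσ h
      obtain ⟨τ, hτ, hlt, hd⟩ := hstep σ hσ (by omega)
      obtain ⟨c, ⟨_, hC, hch⟩, hl, hcard⟩ := ih τ hτ (by omega)
      have hb : ∀ b ∈ c, σ < b := fun b hb => hlt.trans_le (hl.2 hb)
      refine ⟨insert σ c, ⟨by simp, ?_, ?_⟩, ?_, ?_⟩
      · rw [Finset.coe_insert]
        exact Set.insert_subset hσ hC
      · rw [Finset.coe_insert]
        exact hch.insert fun b h _ => Or.inl (hb b h).le
      · refine ⟨by simp, fun b h => ?_⟩
        rw [Finset.coe_insert] at h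
        rcases h with rfl | h
        · exact le_rfl
        · exact (hb b h).le
      · rw [Finset.card_insert_of_notMem fun h => (hb σ h).false, hcard]
  have hgreatest : IsGreatest ((fun c : Finset P => c.card - 1) '' (dualFace C σ).faces)
      (m - dim σ) := by
    constructor
    · obtain ⟨c, hc, hl, hcard⟩ := hchain (m - dim σ) σ hσ (by have := hle σ hσ; omega)
      exact ⟨c, ⟨hc.1, c, hc, subset_rfl, hl⟩, by simp [hcard]⟩
    · rintro _ ⟨c, ⟨_, c', ⟨_, hC, hch⟩, hsub, hl⟩, rfl⟩
      -- On a chain above σ the dimension is injective with values between dim σ and m.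
      have hcard : c'.card ≤ (Finset.Icc (dim σ) m).card := by
        refine Finset.card_le_card_of_injOn dim (fun τ hτ => ?_) (fun τ hτ ρ hρ h => ?_)
        · rw [Finset.coe_Icc]
          refine ⟨?_, hle τ (hC hτ)⟩
          rcases (hl.2 hτ).eq_or_lt with h | h
          · rw [h]
          · exact (hmono σ hσ τ (hC hτ) h).le
        · by_contra hne
          rcases hch hτ hρ hne with h' | h'
          · exact (hmono τ (hC hτ) ρ (hC hρ) (h'.lt_of_ne hne)).ne h
          · exact (hmono ρ (hC hρ) τ (hC hτ) (h'.lt_of_ne' hne)).ne h.symm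
      rw [Nat.card_Icc] at hcard
      have := Finset.card_le_card hsub
      have := hle σ hσ
      show c.card - 1 ≤ m - dim σ
      omega
  rw [blockDim, hgreatest.csSup_eq]
  have := hle σ hσ
  omega

/-- Critical faces of the dual matching restricted to the blocks dual to an upward closed set of
faces. -/
theorem mem_criticalFaces_dual {Φ : Set (P × P)} (hΦ : ∀ p ∈ Φ, p.1 ∈ C ∧ p.2 ∈ C ∧ p.1 ≤ p.2)
    (hNC : N ⊆ C) (hN : ∀ σ ∈ N, ∀ τ ∈ C, σ ≤ τ → τ ∈ N) {σ : P} (hσ : σ ∈ N) :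
    dualFace C σ ∈ criticalFaces (dualFace C '' N)
      (restrictMatching (dualMatching C Φ) (dualFace C '' N)) ↔
    (∀ τ, (σ, τ) ∉ Φ) ∧ ∀ τ ∈ N, (τ, σ) ∉ Φ := by
  have hmem : ∀ τ ∈ N, dualFace C τ ∈ dualFace C '' N := fun τ h => ⟨τ, h, rfl⟩
  constructor
  · rintro ⟨-, h⟩
    refine ⟨fun τ hτ => ?_, fun τ hτN hτ => ?_⟩
    · obtain ⟨-, hτC, hle⟩ := hΦ _ hτ
      exact (h (dualFace C τ, dualFace C σ)
        ⟨⟨(σ, τ), hτ, rfl⟩, hmem τ (hN σ hσ τ hτC hle), hmem σ hσ⟩).2 rfl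
    · exact (h (dualFace C σ, dualFace C τ) ⟨⟨(τ, σ), hτ, rfl⟩, hmem σ hσ, hmem τ hτN⟩).1 rfl
  · rintro ⟨h₁, h₂⟩
    refine ⟨hmem σ hσ, ?_⟩
    rintro _ ⟨⟨⟨α, β⟩, hp, rfl⟩, hβ, hα⟩
    obtain ⟨hαC, hβC, -⟩ := hΦ _ hp
    constructor
    · intro h
      obtain rfl := dualFace_injOn (hNC hσ) hβC h
      obtain ⟨ρ, hρ, hρα⟩ := hα
      obtain rfl := dualFace_injOn (hNC hρ) hαC hρα
      exact h₂ ρ hρ hp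
    · intro h
      obtain rfl := dualFace_injOn (hNC hσ) hαC h
      exact h₁ β hp

/-- A partner below σ drops one dimension, which accounts for the shift by one in the second set. -/
theorem nonempty_equiv_criticalFacesOfDim_dual {dim : P → ℕ} {d : ℕ}
    (hd : ∀ σ ∈ C, blockDim (dualFace C σ) + dim σ = d) {Φ : Set (P × P)}
    (hΦ : IsDiscreteVectorField C dim Φ)
    (hNC : N ⊆ C) (hN : ∀ σ ∈ N, ∀ τ ∈ C, σ ≤ τ → τ ∈ N) (i : ℕ) :
    Nonempty (↥(criticalFacesOfDim (dualFace C '' N) blockDim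
        (restrictMatching (dualMatching C Φ) (dualFace C '' N)) i) ≃
      ↥({σ | σ ∈ criticalFaces C Φ ∧ dim σ + i = d ∧ σ ∈ N} ∪
        {σ | σ ∉ N ∧ (∃ τ ∈ N, (σ, τ) ∈ Φ) ∧ dim σ + i + 1 = d})) := by
  classical
  have hΦ' : ∀ p ∈ Φ, p.1 ∈ C ∧ p.2 ∈ C ∧ p.1 ≤ p.2 := fun p hp =>
    ⟨(hΦ.mem p hp).1, (hΦ.mem p hp).2, (hΦ.codimOne p hp).1⟩
  have hcrit {σ : P} (hσ : σ ∈ N) := mem_criticalFaces_dual hΦ' hNC hN hσ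
  set R : Set P := {σ | σ ∈ criticalFaces C Φ ∧ dim σ + i = d ∧ σ ∈ N} ∪
        {σ | σ ∉ N ∧ (∃ τ ∈ N, (σ, τ) ∈ Φ) ∧ dim σ + i + 1 = d} with hR
  -- Critical faces stay put; a face matched upwards into N moves to its partner.
  let g : P → P := fun σ => if h : ∃ τ ∈ N, (σ, τ) ∈ Φ then h.choose else σ
  have hg₁ : ∀ {σ}, σ ∈ criticalFaces C Φ → g σ = σ := fun {σ} h => by
    refine dif_neg ?_
    rintro ⟨τ, -, hτ⟩
    exact (h.2 _ hτ).1 rfl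
  have hg₂ : ∀ {σ τ}, (σ, τ) ∈ Φ → τ ∈ N → g σ = τ := fun {σ τ} h hτ => by
    have hex : ∃ τ ∈ N, (σ, τ) ∈ Φ := ⟨τ, hτ, h⟩
    have heq : g σ = hex.choose := dif_pos hex
    rw [heq]
    exact congrArg Prod.snd (hΦ.unique _ hex.choose_spec.2 _ h σ (Or.inl rfl) (Or.inl rfl))
  have hbij : Set.BijOn (fun σ => dualFace C (g σ)) R
      (criticalFacesOfDim (dualFace C '' N) blockDim
        (restrictMatching (dualMatching C Φ) (dualFace C '' N)) i) := by
    refine ⟨?_, ?_, ?_⟩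
    · rintro σ (⟨hσ, hdim, hσN⟩ | ⟨hσN, ⟨τ, hτN, hp⟩, hdim⟩)
      · simp only [hg₁ hσ]
        refine ⟨(hcrit hσN).2 ⟨fun τ h => (hσ.2 _ h).1 rfl, fun τ _ h => (hσ.2 _ h).2 rfl⟩, ?_⟩
        have := hd σ hσ.1
        omega
      · simp only [hg₂ hp hτN]
        refine ⟨(hcrit hτN).2 ⟨fun ρ h => ?_, fun ρ hρN h => ?_⟩, ?_⟩
        -- Both pairs contain τ, so they agree and ρ = τ, contradicting dim ρ = dim τ + 1.
        · have := congrArg Prod.snd (hΦ.unique _ h _ hp τ (Or.inl rfl) (Or.inr rfl))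
          have hc := (hΦ.codimOne _ h).2
          simp only at this hc
          rw [this] at hc
          omega
        · have := congrArg Prod.fst (hΦ.unique _ h _ hp τ (Or.inr rfl) (Or.inr rfl))
          simp only at this
          exact hσN (this ▸ hρN)
        · have := hd τ (hNC hτN)
          have hc := (hΦ.codimOne _ hp).2
          simp only at hc
          omega
    · intro σ hσ τ hτ h
      have hgC : ∀ {ρ}, ρ ∈ R → g ρ ∈ C := by
        rintro ρ (⟨hρ, -, hρN⟩ | ⟨-, ⟨τ, hτN, hp⟩, -⟩)
        · rw [hg₁ hρ]
          exact hρ.1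
        · rw [hg₂ hp hτN]
          exact hNC hτN
      have h' : g σ = g τ := dualFace_injOn (hgC hσ) (hgC hτ) h
      rcases hσ with ⟨hσ, -, -⟩ | ⟨-, ⟨α, hα, hp⟩, -⟩ <;>
        rcases hτ with ⟨hτ, -, -⟩ | ⟨-, ⟨β, hβ, hq⟩, -⟩
      · rwa [hg₁ hσ, hg₁ hτ] at h'
      · rw [hg₁ hσ, hg₂ hq hβ] at h'
        exact ((hσ.2 _ hq).2 h').elim
      · rw [hg₁ hτ, hg₂ hp hα] at h'
        exact ((hτ.2 _ hp).2 h'.symm).elim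
      · rw [hg₂ hp hα, hg₂ hq hβ] at h'
        exact congrArg Prod.fst (hΦ.unique _ hp _ hq α (Or.inr rfl) (Or.inr h'))
    · rintro K ⟨hK, hdim⟩
      obtain ⟨σ, hσN, rfl⟩ := hK.1
      obtain ⟨h₁, h₂⟩ := (hcrit hσN).1 hK
      have hσd := hd σ (hNC hσN)
      by_cases hex : ∃ τ, (τ, σ) ∈ Φ
      · obtain ⟨τ, hτ⟩ := hex
        have hc := (hΦ.codimOne _ hτ).2
        simp only at hc
        refine ⟨τ, Or.inr ⟨fun h => h₂ τ h hτ, ⟨σ, hσN, hτ⟩, by omega⟩, ?_⟩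
        simp only [hg₂ hτ hσN]
      · have hσ : σ ∈ criticalFaces C Φ := by
          refine ⟨hNC hσN, ?_⟩
          rintro ⟨α, β⟩ hp
          exact ⟨fun h => h₁ β (h ▸ hp), fun h => hex ⟨α, h ▸ hp⟩⟩
        refine ⟨σ, Or.inl ⟨hσ, by omega, hσN⟩, ?_⟩
        simp only [hg₁ hσ]
  exact ⟨hbij.equiv.symm⟩

end DualOrder

/-! ### The restrictions R and R* as explicit sets of faces -/

section Restriction

variable {d : ℕ}

theorem restr_eq (C : Set (Set (Sph d))) (M : Set (Sph d)) : restr C M = {σ ∈ C | σ ⊆ M} := by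
  apply Set.Subset.antisymm
  · rintro σ ⟨D, ⟨⟨hDC, -⟩, hDM⟩, hσ⟩
    exact ⟨hDC hσ, hDM σ hσ⟩
  · rintro σ hσ
    exact ⟨{σ ∈ C | σ ⊆ M}, ⟨⟨fun τ h => h.1, fun α hα β hβ h => ⟨hα, h.trans hβ.2⟩⟩,
      fun τ h => h.2⟩, hσ⟩

/-- Meeting M passes to larger faces, so the blocks dual to faces in N that meet M already form a
subcomplex. -/
theorem dualRestr_image {s N : Set (Set (Sph d))} (hNs : N ⊆ s) (M : Set (Sph d)) :
    dualRestr s (dualFace s '' N) M = dualFace s '' {σ ∈ N | (σ ∩ M).Nonempty} := by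
  apply Set.Subset.antisymm
  · refine Set.sInter_subset_of_mem ⟨⟨?_, ?_⟩, ?_⟩
    · exact Set.image_mono fun σ h => h.1
    · rintro _ ⟨σ, hσ, rfl⟩ _ ⟨τ, hτ, rfl⟩ h
      have hle := (dualFace_le_iff (hNs hτ.1) (hNs hσ)).1 h
      exact ⟨σ, ⟨hσ, hτ.2.mono (Set.inter_subset_inter_left _ hle)⟩, rfl⟩
    · rintro σ hσ hM ⟨τ, hτ, h⟩
      obtain rfl := dualFace_injOn (hNs hτ) hσ h
      exact ⟨τ, ⟨hτ, hM⟩, rfl⟩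
  · rintro _ ⟨σ, hσ, rfl⟩ D ⟨-, hD⟩
    exact hD σ (hNs hσ.1) hσ.2 ⟨σ, hσ.1, rfl⟩

end Restriction

/-! ### Strata, their flats and their dimensions -/

section Geometry

variable {d : ℕ} {A E S : Set (LinSub d)}

theorem Sph.norm_coe (x : Sph d) : ‖(x : EuclideanSpace ℝ (Fin (d + 1)))‖ = 1 := by
  simp

theorem Sph.coe_ne_zero (x : Sph d) : (x : EuclideanSpace ℝ (Fin (d + 1))) ≠ 0 := by
  rw [← norm_ne_zero_iff, x.norm_coe]
  exact one_ne_zero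

theorem Sph.exists_eq_smul {v : EuclideanSpace ℝ (Fin (d + 1))} (hv : v ≠ 0) :
    ∃ y : Sph d, ∃ b : ℝ, 0 < b ∧ v = b • (y : EuclideanSpace ℝ (Fin (d + 1))) := by
  have h : ‖v‖ ≠ 0 := norm_ne_zero_iff.2 hv
  refine ⟨⟨‖v‖⁻¹ • v, ?_⟩, ‖v‖, norm_pos_iff.2 hv, ?_⟩
  · simp [norm_smul, h]
  · simp [smul_smul, h]

theorem Sph.dist_le_of_eq_smul {v : EuclideanSpace ℝ (Fin (d + 1))} {x y : Sph d} {b : ℝ}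
    (hb : 0 < b) (h : (y : EuclideanSpace ℝ (Fin (d + 1))) + v = b • (x : EuclideanSpace ℝ _)) :
    dist x y ≤ 2 * ‖v‖ := by
  -- Here b is the norm of y + v, so it differs from ‖y‖ = 1 by at most ‖v‖.
  have hx : ‖(x : EuclideanSpace ℝ (Fin (d + 1))) - b • (x : EuclideanSpace ℝ _)‖ ≤ ‖v‖ := by
    have h₁ : ‖(x : EuclideanSpace ℝ (Fin (d + 1))) - b • (x : EuclideanSpace ℝ _)‖ = |1 - b| := by
      rw [show (x : EuclideanSpace ℝ (Fin (d + 1))) - b • (x : EuclideanSpace ℝ _) =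
        (1 - b) • (x : EuclideanSpace ℝ (Fin (d + 1))) by rw [sub_smul, one_smul], norm_smul,
        x.norm_coe, mul_one, Real.norm_eq_abs]
    have h₂ := abs_norm_sub_norm_le (y : EuclideanSpace ℝ (Fin (d + 1)))
      ((y : EuclideanSpace ℝ (Fin (d + 1))) + v)
    rw [h₁]
    rw [h, norm_smul, x.norm_coe, y.norm_coe, mul_one, Real.norm_eq_abs, abs_of_pos hb, ← h] at h₂
    simpa using h₂
  rw [Subtype.dist_eq, dist_eq_norm]
  calc ‖(x : EuclideanSpace ℝ (Fin (d + 1))) - y‖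
      = ‖((x : EuclideanSpace ℝ (Fin (d + 1))) - b • (x : EuclideanSpace ℝ _)) + v‖ := by
        rw [← h]
        congr 1
        abel
    _ ≤ 2 * ‖v‖ := (norm_add_le _ _).trans (by linarith)

theorem Sph.eq_of_eq_smul {x y : Sph d} {b : ℝ} (hb : 0 < b)
    (h : (y : EuclideanSpace ℝ (Fin (d + 1))) = b • (x : EuclideanSpace ℝ _)) : x = y := by
  have := Sph.dist_le_of_eq_smul (v := 0) (x := x) (y := y) hb (by simpa using h)
  exact dist_le_zero.1 (by simpa using this)

/-- The radial projection of a path in `ℝ^(d+1)` is a path in the sphere. -/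
theorem joinedIn_locus {f : ℝ → EuclideanSpace ℝ (Fin (d + 1))} (hf : Continuous f)
    (h0 : ∀ t ∈ Set.Icc (0 : ℝ) 1, f t ≠ 0) (hS : ∀ t ∈ Set.Icc (0 : ℝ) 1, ∀ L ∈ S, f t ∈ L)
    (hES : ∀ t ∈ Set.Icc (0 : ℝ) 1, ∀ L ∈ E \ S, f t ∉ L)
    {x y : Sph d} {a b : ℝ} (ha : 0 < a) (hx : f 0 = a • (x : EuclideanSpace ℝ _)) (hb : 0 < b)
    (hy : f 1 = b • (y : EuclideanSpace ℝ _)) : JoinedIn (locus E S) x y := by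
  -- At zeros of f, possible only outside [0, 1], the value is irrelevant.
  have hex : ∀ t : ℝ, ∃ z : Sph d, f t ≠ 0 →
      (z : EuclideanSpace ℝ (Fin (d + 1))) = ‖f t‖⁻¹ • f t := by
    intro t
    by_cases h : f t = 0
    · exact ⟨x, fun h' => (h' h).elim⟩
    · have h' : ‖f t‖ ≠ 0 := norm_ne_zero_iff.2 h
      exact ⟨⟨‖f t‖⁻¹ • f t, by simp [norm_smul, h']⟩, fun _ => rfl⟩
  choose g hg using hex
  have hg' : ∀ t ∈ Set.Icc (0 : ℝ) 1,
      f t = ‖f t‖ • (g t : EuclideanSpace ℝ (Fin (d + 1))) := fun t ht => by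
    rw [hg t (h0 t ht), smul_smul, mul_inv_cancel₀ (norm_ne_zero_iff.2 (h0 t ht)), one_smul]
  have hend : ∀ {t : ℝ} {z : Sph d} {c : ℝ}, t ∈ Set.Icc (0 : ℝ) 1 → 0 < c →
      f t = c • (z : EuclideanSpace ℝ _) → g t = z := fun {t z c} ht hc h => by
    have h₁ : ‖f t‖ = c := by rw [h, norm_smul, z.norm_coe, mul_one, Real.norm_of_nonneg hc.le]
    refine Subtype.ext ?_
    rw [hg t (h0 t ht), h₁, h, smul_smul, inv_mul_cancel₀ hc.ne', one_smul]
  refine JoinedIn.ofLine (f := g) ?_ (hend (by simp) ha hx) (hend (by simp) hb hy) ?_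
  · rw [Topology.IsInducing.subtypeVal.continuousOn_iff]
    refine ContinuousOn.congr (f := fun t => ‖f t‖⁻¹ • f t) ?_ fun t ht => hg t (h0 t ht)
    exact (hf.norm.continuousOn.inv₀ fun t ht => norm_ne_zero_iff.2 (h0 t ht)).smul hf.continuousOn
  · rintro _ ⟨t, ht, rfl⟩
    refine ⟨fun L hL => ?_, fun L hL h => hES t ht L hL ?_⟩
    · show (g t : EuclideanSpace ℝ (Fin (d + 1))) ∈ L
      rw [hg t (h0 t ht)]
      exact L.smul_mem _ (hS t ht L hL)
    · rw [hg' t ht]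
      exact L.smul_mem _ h

/-- A compact subset of a locus stays off the remaining subspaces under small translations. -/
theorem exists_pos_forall_add_notMem (hE : E.Finite) {K : Set (Sph d)} (hK : IsCompact K)
    (hKS : K ⊆ locus E S) : ∃ ε > 0, ∀ u ∈ K, ∀ v : EuclideanSpace ℝ (Fin (d + 1)), ‖v‖ < ε →
      (u : EuclideanSpace ℝ (Fin (d + 1))) + v ≠ 0 ∧
        ∀ L ∈ E \ S, (u : EuclideanSpace ℝ (Fin (d + 1))) + v ∉ L := by
  -- The origin is also avoided, so that radial projection remains possible.
  have hclosed : IsClosed ({0} ∪ ⋃ L ∈ E \ S, (L : Set (EuclideanSpace ℝ (Fin (d + 1))))) :=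
    isClosed_singleton.union <| (hE.sdiff).isClosed_biUnion fun L _ => L.closed_of_finiteDimensional
  obtain ⟨ε, hε, h⟩ := (hK.image continuous_subtype_val).exists_thickening_subset_open
    hclosed.isOpen_compl (by
      rintro _ ⟨u, hu, rfl⟩ (h | h)
      · exact u.coe_ne_zero h
      · simp only [Set.mem_iUnion] at h
        obtain ⟨L, hL, h⟩ := h
        exact (hKS hu).2 L hL h)
  refine ⟨ε, hε, fun u hu v hv => ?_⟩
  have hmem : (u : EuclideanSpace ℝ (Fin (d + 1))) + v ∈
      Metric.thickening ε (Subtype.val '' K) :=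
    Metric.mem_thickening_iff.2 ⟨u, ⟨u, hu, rfl⟩, by simpa using hv⟩
  have hn := h hmem
  simp only [Set.mem_compl_iff, Set.mem_union, Set.mem_singleton_iff, Set.mem_iUnion, not_or,
    not_exists] at hn
  exact ⟨hn.1, fun L hL hm => hn.2 L hL hm⟩

theorem mem_sInf_of_mem_locus {x : Sph d} (hx : x ∈ locus E S) :
    (x : EuclideanSpace ℝ (Fin (d + 1))) ∈ sInf S :=
  Submodule.mem_sInf.2 hx.1

/-- Thus the flat of a nonempty locus determines its label set S. -/
theorem eq_setOf_sInf_le (hS : S ⊆ E) {x : Sph d} (hx : x ∈ locus E S) :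
    S = {L ∈ E | sInf S ≤ L} := by
  apply Set.Subset.antisymm
  · exact fun L hL => ⟨hS hL, sInf_le hL⟩
  · rintro L ⟨hLE, hL⟩
    by_contra h
    exact hx.2 L ⟨hLE, h⟩ (hL (mem_sInf_of_mem_locus hx))

/-- A stratum is relatively open in its flat: for small v the segment from x to x + v stays in the
flat and avoids the origin and the other elements of E, so it projects to a curve in the locus. -/
theorem exists_pos_forall_smul_mem_stratum (hE : E.Finite) {x : Sph d} (hx : x ∈ locus E S) :
    ∃ ε > 0, ∀ v ∈ sInf S, ‖v‖ < ε → ∃ y ∈ pathComponentIn (locus E S) x, ∃ b : ℝ, 0 < b ∧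
      (x : EuclideanSpace ℝ (Fin (d + 1))) + v = b • (y : EuclideanSpace ℝ _) := by
  obtain ⟨ε, hε, h⟩ := exists_pos_forall_add_notMem hE (isCompact_singleton (x := x))
    (Set.singleton_subset_iff.2 hx)
  have h := h x rfl
  refine ⟨ε, hε, fun v hv hvε => ?_⟩
  obtain ⟨y, b, hb, hy⟩ := Sph.exists_eq_smul (h v hvε).1
  have hsmall : ∀ t ∈ Set.Icc (0 : ℝ) 1, ‖t • v‖ < ε := fun t ht => by
    rw [norm_smul, Real.norm_of_nonneg ht.1]
    exact (mul_le_of_le_one_left (norm_nonneg _) ht.2).trans_lt hvε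
  refine ⟨y, ?_, b, hb, hy⟩
  refine joinedIn_locus (f := fun t => (x : EuclideanSpace ℝ (Fin (d + 1))) + t • v)
    (by fun_prop) (fun t ht => (h _ (hsmall t ht)).1) (fun t ht L hL => ?_)
    (fun t ht => (h _ (hsmall t ht)).2) one_pos (by simp) hb (by simpa using hy)
  exact L.add_mem (hx.1 L hL) (L.smul_mem _ (sInf_le hL hv))

theorem exists_pos_forall_dist_lt_mem_stratum (hE : E.Finite) {x : Sph d} (hx : x ∈ locus E S) :
    ∃ ε > 0, ∀ z : Sph d, (z : EuclideanSpace ℝ (Fin (d + 1))) ∈ sInf S → dist z x < ε →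
      z ∈ pathComponentIn (locus E S) x := by
  obtain ⟨ε, hε, h⟩ := exists_pos_forall_smul_mem_stratum hE hx
  refine ⟨ε, hε, fun z hz hzx => ?_⟩
  obtain ⟨y, hy, b, hb, hzy⟩ := h (z - x) (Submodule.sub_mem _ hz (mem_sInf_of_mem_locus hx))
    (by rwa [Subtype.dist_eq, dist_eq_norm] at hzx)
  rw [add_sub_cancel] at hzy
  rwa [← Sph.eq_of_eq_smul hb hzy]

theorem isClosed_trace (L : LinSub d) : IsClosed (trace L) :=
  L.closed_of_finiteDimensional.preimage continuous_subtype_val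

/-- By relative openness, a small multiple of any v in the flat is a difference of multiples of
points of the stratum. -/
theorem span_closure_stratum (hE : E.Finite) {x : Sph d} (hx : x ∈ locus E S) :
    Submodule.span ℝ ((fun x : Sph d => (x : EuclideanSpace ℝ (Fin (d + 1)))) ''
      closure (pathComponentIn (locus E S) x)) = sInf S := by
  apply le_antisymm
  · rw [Submodule.span_le]
    rintro _ ⟨y, hy, rfl⟩
    have hsub : pathComponentIn (locus E S) x ⊆ trace (sInf S) := fun z hz =>
      mem_sInf_of_mem_locus (pathComponentIn_subset hz)
    exact closure_minimal hsub (isClosed_trace _) hy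
  · intro v hv
    obtain ⟨ε, hε, h⟩ := exists_pos_forall_smul_mem_stratum hE hx
    obtain ⟨c, hc, hcv⟩ : ∃ c : ℝ, 0 < c ∧ c * ‖v‖ < ε := by
      refine ⟨ε / (‖v‖ + 1), by positivity, ?_⟩
      rw [div_mul_eq_mul_div, div_lt_iff₀ (by positivity)]
      linarith
    obtain ⟨y, hy, b, -, hxy⟩ := h (c • v) (Submodule.smul_mem _ _ hv)
      (by rwa [norm_smul, Real.norm_of_nonneg hc.le])
    have hmem : ∀ z ∈ pathComponentIn (locus E S) x, (z : EuclideanSpace ℝ (Fin (d + 1))) ∈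
        Submodule.span ℝ ((fun x : Sph d => (x : EuclideanSpace ℝ (Fin (d + 1)))) ''
          closure (pathComponentIn (locus E S) x)) := fun z hz =>
      Submodule.subset_span ⟨z, subset_closure hz, rfl⟩
    rw [← Submodule.smul_mem_iff _ hc.ne', ← add_sub_cancel_left (x : EuclideanSpace ℝ _) (c • v),
      hxy]
    exact Submodule.sub_mem _ (Submodule.smul_mem _ _ (hmem y hy))
      (hmem x (mem_pathComponentIn_self hx))

theorem sphDim_closure_stratum (hE : E.Finite) {x : Sph d} (hx : x ∈ locus E S) :
    sphDim (closure (pathComponentIn (locus E S) x)) + 1 = Module.finrank ℝ ↥(sInf S) := by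
  rw [sphDim, span_closure_stratum hE hx]
  -- The flat contains x ≠ 0, so the truncated subtraction in `sphDim` loses nothing.
  refine Nat.sub_add_cancel (Submodule.one_le_finrank_iff.2 ?_)
  exact (Submodule.ne_bot_iff _).2 ⟨x, mem_sInf_of_mem_locus hx, x.coe_ne_zero⟩

theorem mem_stratFaces {σ : Set (Sph d)} : σ ∈ stratFaces E ↔
    ∃ S ⊆ E, ∃ x ∈ locus E S, σ = closure (pathComponentIn (locus E S) x) := by
  constructor
  · rintro ⟨T, ⟨hne, S, hS, x, rfl⟩, rfl⟩
    exact ⟨S, hS, x, pathComponentIn_nonempty_iff.1 hne, rfl⟩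
  · rintro ⟨S, hS, x, hx, rfl⟩
    exact ⟨_, ⟨pathComponentIn_nonempty_iff.2 hx, S, hS, x, rfl⟩, rfl⟩

theorem sphDim_le (hE : E.Finite) {σ : Set (Sph d)} (hσ : σ ∈ stratFaces E) : sphDim σ ≤ d := by
  obtain ⟨S, -, x, hx, rfl⟩ := mem_stratFaces.1 hσ
  have h₁ := sphDim_closure_stratum hE hx
  have h₂ := Submodule.finrank_le (sInf S)
  rw [finrank_euclideanSpace_fin] at h₂
  omega

/-- Inclusion of faces gives inclusion of flats. If the flats agreed, so would the label sets;
relative openness would then give the two path components a common point, forcing the faces to be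
equal. -/
theorem sphDim_lt_sphDim (hE : E.Finite) {σ τ : Set (Sph d)} (hσ : σ ∈ stratFaces E)
    (hτ : τ ∈ stratFaces E) (h : σ < τ) : sphDim σ < sphDim τ := by
  obtain ⟨S, hS, x, hx, rfl⟩ := mem_stratFaces.1 hσ
  obtain ⟨S', hS', y, hy, rfl⟩ := mem_stratFaces.1 hτ
  have h₁ := sphDim_closure_stratum hE hx
  have h₂ := sphDim_closure_stratum hE hy
  have hle : sInf S ≤ sInf S' := by
    rw [← span_closure_stratum hE hx, ← span_closure_stratum hE hy]
    exact Submodule.span_mono (Set.image_mono h.le)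
  rcases hle.eq_or_lt with heq | hlt
  · exfalso
    have hSS' : S = S' := by
      rw [eq_setOf_sInf_le hS hx, eq_setOf_sInf_le hS' hy, heq]
    subst hSS'
    obtain ⟨ε, hε, hball⟩ := exists_pos_forall_dist_lt_mem_stratum hE hx
    obtain ⟨z, hz, hxz⟩ := Metric.mem_closure_iff.1
      (h.le (subset_closure (mem_pathComponentIn_self hx))) ε hε
    have hzx := hball z (mem_sInf_of_mem_locus (pathComponentIn_subset hz)) (by rwa [dist_comm])
    rw [← pathComponentIn_congr hzx, ← pathComponentIn_congr hz] at h
    exact h.false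
  · have := Submodule.finrank_lt_finrank_of_lt hlt
    omega

/-! ### Raising flats and faces by one dimension -/

theorem finrank_inf_add_one_of_isHyperplane {W H : LinSub d} (hH : IsHyperplane H)
    (hW : ¬ W ≤ H) : Module.finrank ℝ ↥(W ⊓ H) + 1 = Module.finrank ℝ W := by
  have h₁ := Submodule.finrank_sup_add_finrank_inf_eq W H
  have h₂ := Submodule.finrank_lt_finrank_of_lt
    (lt_of_le_of_ne (le_sup_right : H ≤ W ⊔ H) fun h => hW (h ▸ le_sup_left))
  have h₃ := Submodule.finrank_le (W ⊔ H)
  rw [finrank_euclideanSpace_fin] at h₃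
  rw [IsHyperplane] at hH
  omega

/-- Every proper flat of an extension is covered by a flat of one more dimension. -/
theorem exists_flat_finrank_eq_add_one (hA : IsCodimTwoArrangement A) (hE : IsExtension A E)
    (hS : S ⊆ E) (hSE : S = {L ∈ E | sInf S ≤ L}) (htop : sInf S ≠ ⊤) :
    ∃ S' ⊆ E, sInf S ≤ sInf S' ∧
      Module.finrank ℝ ↥(sInf S') = Module.finrank ℝ ↥(sInf S) + 1 := by
  -- W is minimal among the intersections of subfamilies of S that strictly contain the flat of S;
  -- the empty subfamily gives the whole space.
  obtain ⟨W, ⟨S', hS', rfl, hlt⟩, hmin⟩ := (wellFounded_lt (α := LinSub d)).has_min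
    {W | ∃ S' ⊆ S, W = sInf S' ∧ sInf S < W}
    ⟨⊤, ∅, Set.empty_subset _, by simp, lt_top_iff_ne_top.2 htop⟩
  refine ⟨S', hS'.trans hS, hlt.le, ?_⟩
  have hinf : ∀ L ∈ S, ¬ sInf S' ≤ L → sInf S' ⊓ L = sInf S := fun L hL hn => by
    by_contra hne
    refine hmin (sInf S' ⊓ L) ⟨insert L S', Set.insert_subset hL hS', ?_, ?_⟩
      (inf_lt_left.2 hn)
    · rw [sInf_insert, inf_comm]
    · exact lt_of_le_of_ne (le_inf hlt.le (sInf_le hL)) (Ne.symm hne)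
  obtain ⟨L, hL, hn⟩ : ∃ L ∈ S, ¬ sInf S' ≤ L := by
    by_contra! h
    exact hlt.not_ge (le_sInf h)
  have hyper : ∀ H ∈ S, IsHyperplane H → ¬ sInf S' ≤ H →
      Module.finrank ℝ ↥(sInf S') = Module.finrank ℝ ↥(sInf S) + 1 := fun H hHS hH hn => by
    rw [← finrank_inf_add_one_of_isHyperplane hH hn, hinf H hHS hn]
  rcases hE.mem L (hS hL) with hH | hLA
  · exact hyper L hL hH hn
  · obtain ⟨H, hHE, hH, hLH⟩ := hE.exists_hyperplane L hLA
    -- If W lies in H, then L has codimension one in H, so W + L = H and W ∩ L has codimension one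
    -- in W. Otherwise H, which belongs to S, cuts W itself.
    by_cases hle : sInf S' ≤ H
    · have h₁ := Submodule.finrank_sup_add_finrank_inf_eq (sInf S') L
      have h₂ := Submodule.finrank_lt_finrank_of_lt
        (lt_of_le_of_ne (le_sup_right : L ≤ sInf S' ⊔ L) fun h => hn (h ▸ le_sup_left))
      have h₃ := Submodule.finrank_mono (sup_le hle hLH)
      have h₄ := hA.2 L hLA
      rw [hinf L hL hn] at h₁
      rw [IsHyperplane] at hH
      omega
    · refine hyper H ?_ hH hle
      rw [hSE]
      exact ⟨hHE, (sInf_le hL).trans hLH⟩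

/-- The stratum of x is pushed off its flat V in a direction w of a flat W of one more dimension.
All pushed points lie in one stratum of W, and letting the push tend to zero puts the original
stratum in its closure. -/
theorem exists_mem_stratFaces_sphDim_eq_add_one (hA : IsCodimTwoArrangement A)
    (hE : IsExtension A E) {σ : Set (Sph d)} (hσ : σ ∈ stratFaces E) (hd : sphDim σ < d) :
    ∃ τ ∈ stratFaces E, σ < τ ∧ sphDim τ = sphDim σ + 1 := by
  obtain ⟨S, hS, x, hx, rfl⟩ := mem_stratFaces.1 hσ
  have hdim := sphDim_closure_stratum hE.finite hx
  obtain ⟨S₀, hS₀, hle, hrank⟩ := exists_flat_finrank_eq_add_one hA hE hS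
    (eq_setOf_sInf_le hS hx) (fun htop => by
      rw [htop, finrank_top, finrank_euclideanSpace_fin] at hdim
      omega)
  set V := sInf S with hV
  set W := sInf S₀ with hW
  -- A locus is labelled by all elements of E containing its flat, so S₀ is enlarged accordingly.
  set S' : Set (LinSub d) := {L ∈ E | W ≤ L} with hS'
  have hWS' : sInf S' = W :=
    le_antisymm (le_sInf fun L hL => sInf_le ⟨hS₀ hL, sInf_le hL⟩) (le_sInf fun L hL => hL.2)
  obtain ⟨w, hwW, hwV⟩ : ∃ w ∈ W, w ∉ V := by
    by_contra! h
    have := Submodule.finrank_mono (show W ≤ V from h)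
    omega
  -- V has codimension one in W, so V and w together span W.
  have hLW : ∀ L : LinSub d, V ≤ L → w ∈ L → W ≤ L := fun L hVL hwL => by
    have hlt : V < L ⊓ W := lt_of_le_of_ne (le_inf hVL hle) fun h => hwV (h ▸ ⟨hwL, hwW⟩)
    have := Submodule.finrank_lt_finrank_of_lt hlt
    exact inf_eq_right.1 (Submodule.eq_of_le_of_finrank_le inf_le_right (by omega))
  have hmem : ∀ u ∈ locus E S, ∀ t : ℝ, ∀ L ∈ S',
      (u : EuclideanSpace ℝ (Fin (d + 1))) + t • w ∈ L := fun u hu t L hL =>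
    L.add_mem (hL.2 (hle (mem_sInf_of_mem_locus hu))) (L.smul_mem _ (hL.2 hwW))
  have hpush : ∀ {K : Set (Sph d)}, IsCompact K → K ⊆ locus E S → ∃ δ > 0, ∀ u ∈ K,
      ∀ t : ℝ, 0 < t → t < δ → (u : EuclideanSpace ℝ (Fin (d + 1))) + t • w ≠ 0 ∧
        ∀ L ∈ E \ S', (u : EuclideanSpace ℝ (Fin (d + 1))) + t • w ∉ L := by
    intro K hK hKS
    obtain ⟨ε, hε, h⟩ := exists_pos_forall_add_notMem hE.finite hK hKS
    refine ⟨ε / (‖w‖ + 1), by positivity, fun u hu t ht htδ => ?_⟩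
    have hsmall : ‖t • w‖ < ε := by
      rw [lt_div_iff₀ (by positivity)] at htδ
      rw [norm_smul, Real.norm_of_nonneg ht.le]
      linarith
    obtain ⟨h₁, h₂⟩ := h u hu _ hsmall
    refine ⟨h₁, fun L hL hm => ?_⟩
    -- Elements outside S are avoided by compactness. One in S contains u, so containing u + tw
    -- would force it to contain w, hence W.
    by_cases hLS : L ∈ S
    · have huL := (hKS hu).1 L hLS
      have hw : w ∈ L := (L.smul_mem_iff ht.ne').1 ((L.add_mem_iff_right huL).1 hm)
      exact hL.2 ⟨hL.1, hLW L (sInf_le hLS) hw⟩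
    · exact h₂ L ⟨hL.1, hLS⟩ hm
  obtain ⟨δ, hδ, hxδ⟩ := hpush (isCompact_singleton (x := x)) (Set.singleton_subset_iff.2 hx)
  have hxδ := hxδ x rfl
  have hδ2 : 0 < δ / 2 := by positivity
  obtain ⟨z, b, hb, hz⟩ := Sph.exists_eq_smul (hxδ (δ / 2) hδ2 (by linarith)).1
  -- All small positive pushes of x project into the stratum of z, by varying t linearly from δ/2.
  have hxz : ∀ t : ℝ, 0 < t → t < δ → ∀ y : Sph d, ∀ c : ℝ, 0 < c →
      (x : EuclideanSpace ℝ (Fin (d + 1))) + t • w = c • (y : EuclideanSpace ℝ _) →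
      JoinedIn (locus E S') z y := by
    intro t ht htδ y c hc hy
    have hr : ∀ s ∈ Set.Icc (0 : ℝ) 1,
        0 < δ / 2 + s * (t - δ / 2) ∧ δ / 2 + s * (t - δ / 2) < δ := fun s hs => by
      obtain ⟨h0, h1⟩ := hs
      constructor
      · rcases le_total t (δ / 2) with h | h <;> nlinarith
      · rcases le_total t (δ / 2) with h | h <;> nlinarith
    exact joinedIn_locus
      (f := fun s => (x : EuclideanSpace ℝ (Fin (d + 1))) + (δ / 2 + s * (t - δ / 2)) • w)
      (by fun_prop) (fun s hs => (hxδ _ (hr s hs).1 (hr s hs).2).1) (fun s hs => hmem x hx _)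
      (fun s hs => (hxδ _ (hr s hs).1 (hr s hs).2).2) hb (by simpa using hz) hc (by simpa using hy)
  have hzS' : z ∈ locus E S' := (hxz (δ / 2) hδ2 (by linarith) z b hb hz).source_mem
  have hdim' := sphDim_closure_stratum hE.finite hzS'
  rw [hWS'] at hdim'
  have hsucc : sphDim (closure (pathComponentIn (locus E S') z)) =
      sphDim (closure (pathComponentIn (locus E S) x)) + 1 := by omega
  refine ⟨_, mem_stratFaces.2 ⟨S', fun L hL => hL.1, z, hzS', rfl⟩, ?_, hsucc⟩
  refine lt_of_le_of_ne ?_ fun h => ?_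
  · refine closure_minimal (fun y hy => ?_) isClosed_closure
    -- The whole path from x to y is pushed by the same t, small enough by compactness; this joins
    -- the pushed x to the pushed y.
    let γ := JoinedIn.somePath hy
    have hγS : Set.range γ ⊆ locus E S := by
      rintro _ ⟨t, rfl⟩
      exact JoinedIn.somePath_mem hy t
    obtain ⟨η, hη, hγ⟩ := hpush (isCompact_range γ.continuous) hγS
    rw [Metric.mem_closure_iff]
    intro ε hε
    -- The factor 2 is that of `Sph.dist_le_of_eq_smul`: projecting back to the sphere at most
    -- doubles the displacement.
    obtain ⟨t, ht0, htδ, htη, htε⟩ : ∃ t : ℝ, 0 < t ∧ t < δ ∧ t < η ∧ 2 * (t * ‖w‖) < ε := by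
      have hε' : 0 < ε / (2 * (‖w‖ + 1)) := by positivity
      obtain ⟨t, ht0, ht⟩ := exists_between (lt_min (lt_min hδ hη) hε')
      rw [lt_min_iff, lt_min_iff, lt_div_iff₀ (by positivity)] at ht
      exact ⟨t, ht0, ht.1.1, ht.1.2, by linarith [ht.2]⟩
    obtain ⟨x', a, ha, hx'⟩ := Sph.exists_eq_smul (hxδ t ht0 htδ).1
    obtain ⟨y', c, hc, hy'⟩ := Sph.exists_eq_smul (hγ y ⟨1, γ.target⟩ t ht0 htη).1
    have hrange : ∀ s : ℝ, γ.extend s ∈ Set.range γ := fun s => by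
      rw [← γ.extend_range]
      exact Set.mem_range_self s
    refine ⟨y', (hxz t ht0 htδ x' a ha hx').trans ?_, ?_⟩
    · exact joinedIn_locus
        (f := fun s => (γ.extend s : EuclideanSpace ℝ (Fin (d + 1))) + t • w)
        ((continuous_subtype_val.comp γ.continuous_extend).add continuous_const)
        (fun s _ => (hγ _ (hrange s) t ht0 htη).1) (fun s _ => hmem _ (hγS (hrange s)) t)
        (fun s _ => (hγ _ (hrange s) t ht0 htη).2) ha (by simpa using hx') hc (by simpa using hy')
    · rw [dist_comm]
      refine (Sph.dist_le_of_eq_smul hc hy').trans_lt ?_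
      rwa [norm_smul, Real.norm_of_nonneg ht0.le]
  · rw [← h] at hsucc
    omega

theorem blockDim_dualFace_add_sphDim (hA : IsCodimTwoArrangement A) (hE : IsExtension A E)
    {σ : Set (Sph d)} (hσ : σ ∈ stratFaces E) :
    blockDim (dualFace (stratFaces E) σ) + sphDim σ = d :=
  blockDim_dualFace_add (fun _ h => sphDim_le hE.finite h)
    (fun _ h _ h' => sphDim_lt_sphDim hE.finite h h')
    (fun _ h h' => exists_mem_stratFaces_sphDim_eq_add_one hA hE h h') hσ

end Geometry

/-! ### The complement complex and the outwardly matched faces -/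

section Matching

/-- A face is outside R(s, A) exactly when it is not contained in the arrangement, that is, when it
meets the complement. -/
theorem complementComplex_eq {d : ℕ} (A : Set (LinSub d)) (s : Set (Set (Sph d))) :
    complementComplex A s = dualFace s '' {σ ∈ s | σ ∉ restr s (support A)} := by
  rw [complementComplex, dualComplex, dualRestr_image subset_rfl]
  congr 1
  ext σ
  refine and_congr_right fun hσ => ?_
  rw [Set.inter_compl_nonempty_iff, restr_eq]
  simp [hσ]

/-- The faces matched across the boundary of the subcomplex `R(s, M)`. -/
theorem mem_outwardlyMatched_restr {d : ℕ} {s : Set (Set (Sph d))}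
    {Φ : Set (Set (Sph d) × Set (Sph d))} (hΦ : IsDiscreteVectorField s sphDim Φ)
    {M : Set (Sph d)} {σ : Set (Sph d)} : σ ∈ outwardlyMatched (restr s M) Φ ↔
      σ ∈ restr s M ∧ ∃ τ ∈ s, τ ∉ restr s M ∧ (σ, τ) ∈ Φ := by
  refine and_congr_right fun hσ => ⟨?_, ?_⟩
  · rintro ⟨τ, hτ, h | h⟩
    · exact ⟨τ, (hΦ.mem _ h).2, hτ, h⟩
    · rw [restr_eq] at hσ hτ
      exact (hτ ⟨(hΦ.mem _ h).1, (hΦ.codimOne _ h).1.trans hσ.2⟩).elim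
  · rintro ⟨τ, -, hτ, h⟩
    exact ⟨τ, hτ, Or.inl h⟩

end Matching

end MorseDuality

theorem mainTheorem6 (d : ℕ) (A E : Set (LinSub d))
    (hA : IsCodimTwoArrangement A) (hE : IsExtension A E) (hfine : IsFine E)
    (Φ : Set (Set (Sph d) × Set (Sph d)))
    (hΦ : IsMorseMatching (stratFaces E) sphDim Φ) :
    (∀ i : ℕ, Nonempty
      (↥(criticalFacesOfDim (complementComplex A (stratFaces E)) blockDim
          (restrictMatching (dualMatching (stratFaces E) Φ)
            (complementComplex A (stratFaces E))) i) ≃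
        ↥({σ | σ ∈ criticalFaces (stratFaces E) Φ ∧ sphDim σ + i = d ∧
              σ ∉ restr (stratFaces E) (support A)} ∪
          {σ | σ ∈ outwardlyMatched (restr (stratFaces E) (support A)) Φ ∧
              sphDim σ + i + 1 = d}))) ∧
    (∀ M : Set (Sph d), IsOpen M →
      (∀ σ ∈ stratFaces E, σ ∉ criticalFaces (stratFaces E) Φ → (σ ∩ M).Nonempty) →
      ∀ i : ℕ, Nonempty
        (↥(criticalFacesOfDim (dualRestr (stratFaces E) (complementComplex A (stratFaces E)) M)
            blockDim
            (restrictMatching (dualMatching (stratFaces E) Φ)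
              (dualRestr (stratFaces E) (complementComplex A (stratFaces E)) M)) i) ≃
          ↥({σ | σ ∈ criticalFaces (stratFaces E) Φ ∧ sphDim σ + i = d ∧
                σ ∉ restr (stratFaces E) (support A) ∧ (σ ∩ M).Nonempty} ∪
            {σ | σ ∈ outwardlyMatched (restr (stratFaces E) (support A)) Φ ∧
                sphDim σ + i + 1 = d}))) := by
  have hvf := hΦ.vectorField
  have hd : ∀ σ ∈ stratFaces E, blockDim (dualFace (stratFaces E) σ) + sphDim σ = d :=
    fun σ hσ => blockDim_dualFace_add_sphDim hA hE hσ
  have hup : ∀ σ ∈ stratFaces E, σ ∉ restr (stratFaces E) (support A) → ∀ τ ∈ stratFaces E,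
      σ ≤ τ → τ ∉ restr (stratFaces E) (support A) := fun σ hσ h τ _ hle hτ' => by
    rw [restr_eq] at h hτ'
    exact h ⟨hσ, hle.trans hτ'.2⟩
  rw [complementComplex_eq]
  refine ⟨fun i => ?_, fun M _ hMΦ i => ?_⟩
  · obtain ⟨e⟩ := nonempty_equiv_criticalFacesOfDim_dual hd hvf
      (N := {σ ∈ stratFaces E | σ ∉ restr (stratFaces E) (support A)}) (fun σ h => h.1)
      (fun σ hσ τ hτ hle => ⟨hτ, hup σ hσ.1 hσ.2 τ hτ hle⟩) i
    refine ⟨e.trans (Equiv.setCongr (congrArg₂ _ ?_ ?_))⟩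
    · ext σ
      exact and_congr_right fun hσ => and_congr_right fun _ =>
        ⟨fun h => h.2, fun h => ⟨hσ.1, h⟩⟩
    · ext σ
      simp only [Set.mem_ofPred_eq, mem_outwardlyMatched_restr hvf]
      constructor
      · rintro ⟨hσ, ⟨τ, hτ, hp⟩, hdim⟩
        exact ⟨⟨not_not.1 fun h => hσ ⟨(hvf.mem _ hp).1, h⟩, τ, hτ.1, hτ.2, hp⟩, hdim⟩
      · rintro ⟨⟨hσ, τ, hτs, hτ, hp⟩, hdim⟩
        exact ⟨fun h => h.2 hσ, ⟨τ, ⟨hτs, hτ⟩, hp⟩, hdim⟩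
  -- Both members of every pair meet M, so restricting to M separates no pair, and a partner outside
  -- N must lie in R(s, A).
  · have hmeet : ∀ p ∈ Φ, (p.1 ∩ M).Nonempty ∧ (p.2 ∩ M).Nonempty := fun p hp =>
      ⟨hMΦ _ (hvf.mem p hp).1 fun h => (h.2 p hp).1 rfl,
        hMΦ _ (hvf.mem p hp).2 fun h => (h.2 p hp).2 rfl⟩
    rw [dualRestr_image fun σ h => h.1]
    obtain ⟨e⟩ := nonempty_equiv_criticalFacesOfDim_dual hd hvf
      (N := {σ ∈ {σ ∈ stratFaces E | σ ∉ restr (stratFaces E) (support A)} | (σ ∩ M).Nonempty})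
      (fun σ h => h.1.1)
      (fun σ hσ τ hτ hle => ⟨⟨hτ, hup σ hσ.1.1 hσ.1.2 τ hτ hle⟩,
        hσ.2.mono (Set.inter_subset_inter_left _ hle)⟩) i
    refine ⟨e.trans (Equiv.setCongr (congrArg₂ _ ?_ ?_))⟩
    · ext σ
      exact and_congr_right fun hσ => and_congr_right fun _ =>
        ⟨fun h => ⟨h.1.2, h.2⟩, fun h => ⟨⟨hσ.1, h.1⟩, h.2⟩⟩
    · ext σ
      simp only [Set.mem_ofPred_eq, mem_outwardlyMatched_restr hvf]
      constructor
      · rintro ⟨hσ, ⟨τ, hτ, hp⟩, hdim⟩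
        exact ⟨⟨not_not.1 fun h => hσ ⟨⟨(hvf.mem _ hp).1, h⟩, (hmeet _ hp).1⟩,
          τ, hτ.1.1, hτ.1.2, hp⟩, hdim⟩
      · rintro ⟨⟨hσ, τ, hτs, hτ, hp⟩, hdim⟩
        exact ⟨fun h => h.1.2 hσ, ⟨τ, ⟨⟨hτs, hτ⟩, (hmeet _ hp).2⟩, hp⟩, hdim⟩
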